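/- Let $F$ be a non-discrete non-Archimedean local field with valuation ring $\mathcal{O}_F$ and finite residue field of cardinality $q$, let $|\cdot|$ be the standard absolute value on $F$ (so that $|\varpi|=q^{-1}$ for every generator $\varpi$ of the maximal ideal of $\mathcal{O}_F$), and let $\mathfrak{m}$ be the Haar measure on $F$ with $\mathfrak{m}(\mathcal{O}_F)=1$. Write $B(0,q^n)=\{x\in F: |x|\le q^n\}$. Fix a continuous character $\chi$ of the additive group $F$ that is trivial on $\mathcal{O}_F$ and not constant on $\varpi^{-1}\mathcal{O}_F=B(0,q)$, and put $\widehat{f}(y)=\int_F f(x)\chi(xy)\,\mathrm{d}\mathfrak{m}(x)$ for $f\in L^1(F,\mathfrak{m})$. A random point process $\mathcal{X}$ on $F$ is a random locally finite subset of $F$. It is a determinantal point process induced by a kernel $K:F\times F\to\mathbb{C}$ if, for every $n\ge 1$ and every compactly supported bounded measurable $\varphi:F^n\to\mathbb{C}$, $$\mathbb{E}\Big(\sum\nolimits^{*}_{x_1,\dots,x_n\in\mathcal{X}}\varphi(x_1,\dots,x_n)\Big)=\int_{F^n}\varphi(y_1,\dots,y_n)\det\big(K(y_i,y_j)\big)_{1\le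 i,j\le n}\,\mathrm{d}\mathfrak{m}(y_1)\cdots\mathrm{d}\mathfrak{m}(y_n),$$ where $\sum^*$ is over ordered $n$-tuples of distinct points of $\mathcal{X}$ and the expectation on the left is required to exist. It is number rigid if, for every bounded open set $B\subset F$, the number $\#(\mathcal{X}\cap B)$ is almost surely determined by $\mathcal{X}\setminus B$, i.e. almost surely equal to a measurable function of $\mathcal{X}\setminus B$. Theorem. Let $S\subset F$ be a measurable subset such that $0<\mathfrak{m}(S)<\infty$ and $$\int_{F\setminus B(0,q^n)}|\widehat{\mathbf{1}_S}|^2\,\mathrm{d}\mathfrak{m}=O(q^{-n})\quad\text{as } n\to\infty.$$ Then every determinantal point process on $F$ induced by the kernel $K_S(x,y)=\widehat{\mathbf{1}_S}(x-y)$ is number rigid. -/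

import Mathlib

open MeasureTheory Filter Asymptotics
open scoped NormedField

noncomputable section

/-- The number `q` of elements of the residue field `𝒪_F / 𝓜_F`, where `𝒪_F = {x | ‖x‖ ≤ 1}` is the
valuation ring of `F` and `𝓜_F` its maximal ideal. -/
def residueCard (F : Type*) [NontriviallyNormedField F] [IsUltrametricDist F] : ℕ :=
  Nat.card (IsLocalRing.ResidueField (Valued.integer F))

/-- The norm of `F` is the standard (normalized) one: there is an element `ϖ` with `‖ϖ‖ = q⁻¹`, and
the maximal ideal `{x | ‖x‖ < 1}` is `ϖ 𝒪_F = {x | ‖x‖ ≤ ‖ϖ‖}`. -/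
def IsStandardNorm (F : Type*) [NontriviallyNormedField F] [IsUltrametricDist F] : Prop :=
  ∃ ϖ : F, ‖ϖ‖ = (residueCard F : ℝ)⁻¹ ∧ ∀ x : F, ‖x‖ < 1 ↔ ‖x‖ ≤ ‖ϖ‖

/-- The Fourier transform `f̂(y) = ∫ f(x) χ(xy) dm(x)` with respect to the additive character `χ`
and the measure `m`. -/
def charFourier {F : Type*} [Field F] [MeasurableSpace F] (χ : AddChar F Circle) (m : Measure F)
    (f : F → ℂ) (y : F) : ℂ :=
  ∫ x, f x * (χ (x * y) : ℂ) ∂m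

/-- Locally finite subsets (configurations) of `F`: subsets meeting every bounded set in finitely
many points. When bounded closed sets of `F` are compact, as in a locally compact normed field,
this is the same as having finitely many points in every compact set. -/
def Configuration (F : Type*) [PseudoMetricSpace F] : Type _ :=
  {s : Set F // ∀ B : Set F, Bornology.IsBounded B → (s ∩ B).Finite}

namespace Configuration

variable {F : Type*} [PseudoMetricSpace F]

/-- The number `#(s ∩ B)` of particles of `s` in `B` (used for bounded `B`, where it is finite). -/
def count (B : Set F) (s : Configuration F) : ℕ := (s.1 ∩ B).ncard

/-- The configuration `s \ B` of the particles of `s` outside `B`. -/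
def outside (B : Set F) (s : Configuration F) : Configuration F :=
  ⟨s.1 \ B, fun C hC => (s.2 C hC).subset (Set.inter_subset_inter_left C Set.sdiff_subset)⟩

/-- The usual σ-algebra on configurations: the one generated by the particle counts in the bounded
measurable sets. -/
instance instMeasurableSpace [MeasurableSpace F] : MeasurableSpace (Configuration F) :=
  ⨆ B : {B : Set F // MeasurableSet B ∧ Bornology.IsBounded B},
    MeasurableSpace.comap (count B.1) ⊤

/-- The sum `∑* φ(x₁, …, xₙ)` over all ordered `n`-tuples of distinct particles of `s`. It has only
finitely many nonzero terms when `φ` has compact support. -/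
def tupleSum {n : ℕ} (φ : (Fin n → F) → ℂ) (s : Configuration F) : ℂ :=
  ∑ᶠ x ∈ {x : Fin n → F | Function.Injective x ∧ ∀ i, x i ∈ s.1}, φ x

end Configuration

/-- The random point process `X`, defined on a probability space `(Ω, P)`, is a determinantal point
process with correlation kernel `K` with respect to the reference measure `m`. -/
def IsDeterminantal {F Ω : Type*} [PseudoMetricSpace F] [MeasurableSpace F] [MeasurableSpace Ω]
    (P : Measure Ω) (X : Ω → Configuration F) (m : Measure F) (K : F → F → ℂ) : Prop :=
  ∀ n : ℕ, 0 < n → ∀ φ : (Fin n → F) → ℂ,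
    Measurable φ → (∃ C : ℝ, ∀ x, ‖φ x‖ ≤ C) → HasCompactSupport φ →
      Integrable (fun ω => (X ω).tupleSum φ) P ∧
      ∫ ω, (X ω).tupleSum φ ∂P =
        ∫ y, φ y * (Matrix.of fun i j => K (y i) (y j)).det ∂(Measure.pi fun _ : Fin n => m)

/-- Number rigidity: for every bounded open `B`, the number of particles in `B` is almost surely a
measurable function of the configuration outside `B`. -/
def IsNumberRigid {F Ω : Type*} [PseudoMetricSpace F] [MeasurableSpace F] [MeasurableSpace Ω]
    (P : Measure Ω) (X : Ω → Configuration F) : Prop :=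
  ∀ B : Set F, IsOpen B → Bornology.IsBounded B →
    ∃ f : Configuration F → ℕ, Measurable f ∧
      ∀ᵐ ω ∂P, (X ω).count B = f ((X ω).outside B)

end

/-!
Write `k` for the Fourier transform of the indicator function of `S`, so that the kernel is
`k (x - y)` with `k 0 = m(S)`, and `N_j` for the number of particles in the ball `B_j` of radius
`q ^ j` around `0`. For `i ≤ j` the first two correlation functions give

  `Cov(N_i, N_j) = m(B_i) * (m(S) - ∫_{B_j} ‖k‖²)`,

because `B_j` is a subgroup: for `x ∈ B_i ⊆ B_j` the integral of `‖k (x - y)‖²` over `y ∈ B_j` does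
not depend on `x` (`IsDeterminantal.integral_centered_mul_centered`). By Plancherel's formula
`∫ ‖k‖² = m(S)`, the factor in parentheses is the integral of `‖k‖²` outside `B_j`
(`setIntegral_compl_norm_charFourier_sq`), so the decay hypothesis and `m(B_i) = q ^ i` bound the
covariance by a constant times `q ^ (i - j)`. The counts in the balls are therefore so weakly
correlated that the averages of `N_j - 𝔼 N_j` over `n₀ ≤ j < n₀ + n` tend to `0` in mean square as
`n → ∞`, and almost surely along a subsequence (`exists_seq_tendsto_average`). If `B_{n₀}` contains
`B`, each `N_j` is the number of particles in `B` plus a count of the outside configuration. Hence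
the number in `B` is minus the limit of averages which depend only on the outside configuration
(`exists_measurable_count_eq`).

Plancherel's formula is needed only for the indicator function of `S`. The integral of `‖k‖²` over
`B_j` equals `q ^ j` times the measure of the pairs of points of `S` at distance at most `q ^ (-j)`,
by orthogonality of characters on `B_j`; this is at most `m(S)`, and tends to `m(S)` by inner and
outer regularity of the Haar measure.
-/

open Metric

/-! ### Balls and characters of the local field -/

section LocalField

open scoped Pointwise

lemma closedBall_eq_units_smul {F : Type*} [NormedField F] (a : Fˣ) (r : ℝ) :
    closedBall (0 : F) (‖(a : F)‖ * r) = a • closedBall (0 : F) r := by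
  have ha : 0 < ‖(a : F)‖ := norm_pos_iff.2 a.ne_zero
  ext x
  rw [Set.mem_smul_set_iff_inv_smul_mem]
  simp only [mem_closedBall_zero_iff, Units.smul_def, smul_eq_mul, norm_mul, Units.val_inv_eq_inv_val,
    norm_inv]
  rw [inv_mul_le_iff₀ ha]

variable {F : Type*} [NontriviallyNormedField F] [IsUltrametricDist F]

/-- The normalization of the norm forces the residue field to be finite: were it infinite,
`residueCard F` would be the junk value `0`, so the uniformizer would be `0` and no element would
have norm in `(0, 1)`. -/
lemma residueCard_ne_zero (hF : IsStandardNorm F) : residueCard F ≠ 0 := by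
  obtain ⟨ϖ, hϖ, h⟩ := hF
  intro h0
  obtain ⟨x, hx0, hx1⟩ := NormedField.exists_norm_lt_one F
  have := (h x).1 hx1
  rw [hϖ, h0] at this
  simp at this
  simp [this] at hx0

lemma finite_residueField (hF : IsStandardNorm F) :
    Finite (IsLocalRing.ResidueField (Valued.integer F)) :=
  Nat.finite_of_card_ne_zero (residueCard_ne_zero hF)

lemma one_lt_residueCard (hF : IsStandardNorm F) : (1 : ℝ) < residueCard F := by
  have := finite_residueField hF
  exact_mod_cast Finite.one_lt_card (α := IsLocalRing.ResidueField (Valued.integer F))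

/-- The nonzero norms of `F` are contained in the powers of `q`: there is no norm strictly between
`q ^ j` and `q ^ (j + 1)`. -/
lemma zpow_add_one_le_norm (hF : IsStandardNorm F) {j : ℤ} {x : F}
    (hx : (residueCard F : ℝ) ^ j < ‖x‖) : (residueCard F : ℝ) ^ (j + 1) ≤ ‖x‖ := by
  have hq : (0 : ℝ) < residueCard F := by linarith [one_lt_residueCard hF]
  obtain ⟨ϖ, hϖ, h⟩ := hF
  have hx0 : 0 < ‖x‖ := (zpow_pos hq j).trans hx
  -- scaled by the `j`-th power of `ϖ`, the inverse of `x` has norm less than `1`, hence at most `q⁻¹`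
  have h1 : ‖ϖ ^ (-j) * x⁻¹‖ = (residueCard F : ℝ) ^ j / ‖x‖ := by
    rw [norm_mul, norm_zpow, hϖ, norm_inv, inv_zpow', neg_neg, div_eq_mul_inv]
  have h2 := (h (ϖ ^ (-j) * x⁻¹)).1 (by rw [h1]; exact (div_lt_one hx0).2 hx)
  rw [h1, hϖ, div_le_iff₀ hx0, ← div_eq_inv_mul, le_div_iff₀ hq] at h2
  rwa [zpow_add_one₀ hq.ne']

lemma exists_uniformizer (hF : IsStandardNorm F) : ∃ ϖ : Fˣ, ‖(ϖ : F)‖ = (residueCard F : ℝ)⁻¹ := by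
  have hq : (0 : ℝ) < residueCard F := by linarith [one_lt_residueCard hF]
  obtain ⟨ϖ, hϖ, -⟩ := hF
  have : ϖ ≠ 0 := by
    rw [← norm_pos_iff, hϖ]; positivity
  exact ⟨Units.mk0 ϖ this, hϖ⟩

variable [MeasurableSpace F] [BorelSpace F] (m : Measure F)
  [m.IsAddHaarMeasure]

/-- The valuation ring is the disjoint union of `q` translates of its maximal ideal. -/
lemma measure_closedBall_one (hF : IsStandardNorm F) :
    m (closedBall 0 1) = residueCard F * m (ball 0 1) := by
  have hfin := finite_residueField hF
  let f : IsLocalRing.ResidueField (Valued.integer F) → Set F := fun r =>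
    {x | ∃ h : x ∈ Valued.integer F, IsLocalRing.residue _ ⟨x, h⟩ = r}
  have hunion : closedBall (0 : F) 1 = ⋃ r, f r := by
    ext x
    simp only [mem_closedBall_zero_iff, f, Set.mem_iUnion, Set.mem_ofPred_eq]
    constructor
    · intro h
      exact ⟨_, Valued.integer.mem_iff.2 h, rfl⟩
    · rintro ⟨_, h, -⟩
      exact Valued.integer.mem_iff.1 h
  have hf : ∀ r, ∃ x : F, f r = (x + ·) '' ball 0 1 := by
    intro r
    obtain ⟨⟨x, hx⟩, rfl⟩ := IsLocalRing.residue_surjective r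
    refine ⟨x, ?_⟩
    have key : ∀ y : Valued.integer F,
        IsLocalRing.residue (Valued.integer F) y = 0 ↔ ‖(y : F)‖ < 1 := by
      intro y
      rw [IsLocalRing.residue_eq_zero_iff, IsLocalRing.mem_maximalIdeal, mem_nonunits_iff,
        Valued.integer.isUnit_iff_norm_eq_one]
      exact ⟨fun h => lt_of_le_of_ne (Valued.integer.norm_le_one y) h, fun h => ne_of_lt h⟩
    ext z
    simp only [f, Set.mem_ofPred_eq, Set.image_add_left, Set.mem_preimage, mem_ball_zero_iff]
    constructor
    · rintro ⟨hz, h⟩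
      rw [← sub_eq_zero, ← map_sub, key] at h
      rw [neg_add_eq_sub]; exact h
    · intro h
      rw [neg_add_eq_sub] at h
      have hz : z ∈ Valued.integer F := by
        have := (Valued.integer F).add_mem (Valued.integer.mem_iff.2 h.le) hx
        simpa using this
      refine ⟨hz, ?_⟩
      rw [← sub_eq_zero, ← map_sub, key]
      exact h
  rw [hunion, measure_iUnion]
  · have : ∀ r, m (f r) = m (ball 0 1) := by
      intro r
      obtain ⟨x, hx⟩ := hf r
      rw [hx, Set.image_add_left, measure_preimage_add]
    simp only [this]
    rw [ENNReal.tsum_const, residueCard, ENat.card_eq_coe_natCard]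
    simp
  · intro r s hrs
    rw [Function.onFun, Set.disjoint_left]
    rintro x ⟨h, hr⟩ ⟨h', hs⟩
    exact hrs (hr.symm.trans hs)
  · intro r
    obtain ⟨x, hx⟩ := hf r
    rw [hx, Set.image_add_left]
    exact measurableSet_ball.preimage (measurable_const_add _)

variable [LocallyCompactSpace F]

/-- The ball of radius `q ^ j` has Haar measure `q ^ j`. -/
lemma measure_closedBall_zpow (hF : IsStandardNorm F) (hm : m (closedBall 0 1) = 1) (x : F) (j : ℤ) :
    m (closedBall x ((residueCard F : ℝ) ^ j)) = (residueCard F : ENNReal) ^ j := by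
  have : ProperSpace F := .of_nontriviallyNormedField_of_weaklyLocallyCompactSpace F
  have hq0 := residueCard_ne_zero hF
  obtain ⟨ϖ, hϖ⟩ := exists_uniformizer hF
  have h0 : ball (0 : F) 1 = ϖ • closedBall (0 : F) 1 := by
    rw [← closedBall_eq_units_smul, hϖ, mul_one]
    ext x
    rw [mem_ball_zero_iff, mem_closedBall_zero_iff]
    obtain ⟨ϖ', hϖ', h⟩ := hF
    rw [h, hϖ']
  have h1 := measure_closedBall_one m hF
  rw [h0, ← distribHaarChar_mul, hm, mul_one] at h1
  -- multiplication by `ϖ` maps the valuation ring onto the maximal ideal, so it scales `m` by `q⁻¹`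
  have h2 : (distribHaarChar F ϖ : ENNReal) = (residueCard F : ENNReal)⁻¹ := by
    rw [mul_comm] at h1
    exact ENNReal.eq_inv_of_mul_eq_one_left h1.symm
  have h3 : (residueCard F : ℝ) ^ j = ‖((ϖ ^ (-j) : Fˣ) : F)‖ * 1 := by
    rw [Units.val_zpow_eq_zpow_val, norm_zpow, hϖ, inv_zpow', neg_neg, mul_one]
  rw [← add_zero x, ← vadd_eq_add, ← vadd_closedBall, measure_vadd, h3, closedBall_eq_units_smul,
    ← distribHaarChar_mul, hm, mul_one]
  have hne : (residueCard F : NNReal) ≠ 0 := by exact_mod_cast hq0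
  have h4 : distribHaarChar F ϖ = (residueCard F : NNReal)⁻¹ := by
    rw [← ENNReal.coe_inj, h2, ENNReal.coe_inv hne]; simp
  rw [map_zpow, h4, inv_zpow', neg_neg, ENNReal.coe_zpow hne]
  simp

lemma measureReal_closedBall_zpow (hF : IsStandardNorm F) (hm : m (closedBall 0 1) = 1) (x : F)
    (j : ℤ) :
    m.real (closedBall x ((residueCard F : ℝ) ^ j)) = (residueCard F : ℝ) ^ j := by
  have hne : (residueCard F : NNReal) ≠ 0 := by exact_mod_cast residueCard_ne_zero hF
  rw [measureReal_def, measure_closedBall_zpow m hF hm, ← ENNReal.coe_natCast,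
    ← ENNReal.coe_zpow hne]
  simp

/-- Orthogonality of characters: `y ↦ χ (u * y)` is trivial on the ball of radius `q ^ j` if
`‖u‖ ≤ q ^ (-j)`; otherwise it is nontrivial there, since `u` then maps this ball onto one of radius
at least `q`, and its integral vanishes. -/
lemma setIntegral_addChar_closedBall (hF : IsStandardNorm F) (hm : m (closedBall 0 1) = 1)
    (χ : AddChar F Circle) (hχ_one : ∀ x : F, ‖x‖ ≤ 1 → χ x = 1)
    (hχ_ne : ∃ x : F, ‖x‖ ≤ (residueCard F : ℝ) ∧ χ x ≠ 1) (u : F) (j : ℤ) :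
    ∫ y in closedBall (0 : F) ((residueCard F : ℝ) ^ j), (χ (u * y) : ℂ) ∂m =
      (closedBall (0 : F) ((residueCard F : ℝ) ^ (-j))).indicator
        (fun _ => ((residueCard F : ℝ) ^ j : ℂ)) u := by
  have hq : (0 : ℝ) < residueCard F := by linarith [one_lt_residueCard hF]
  by_cases hu : ‖u‖ ≤ (residueCard F : ℝ) ^ (-j)
  · rw [Set.indicator_of_mem (by simpa using hu)]
    have : ∀ y ∈ closedBall (0 : F) ((residueCard F : ℝ) ^ j), (χ (u * y) : ℂ) = 1 := by
      intro y hy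
      rw [mem_closedBall_zero_iff] at hy
      rw [hχ_one, Circle.coe_one]
      rw [norm_mul]
      calc _ ≤ (residueCard F : ℝ) ^ (-j) * (residueCard F : ℝ) ^ j := by gcongr
        _ = 1 := by rw [← zpow_add₀ hq.ne']; simp
    rw [setIntegral_congr_fun measurableSet_closedBall this, setIntegral_const,
      measureReal_closedBall_zpow m hF hm]
    simp
  · rw [Set.indicator_of_notMem (by simpa using hu)]
    push Not at hu
    have hu' := zpow_add_one_le_norm hF hu
    have hu0 : 0 < ‖u‖ := (zpow_pos hq _).trans hu
    obtain ⟨x, hx, hx1⟩ := hχ_ne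
    set B := closedBall (0 : F) ((residueCard F : ℝ) ^ j) with hB
    set y₀ := u⁻¹ * x with hy₀
    have hy₀B : ‖y₀‖ ≤ (residueCard F : ℝ) ^ j := by
      rw [hy₀, norm_mul, norm_inv, inv_mul_le_iff₀ hu0]
      calc ‖x‖ ≤ (residueCard F : ℝ) := hx
        _ = (residueCard F : ℝ) ^ (-j + 1) * (residueCard F : ℝ) ^ j := by
          rw [← zpow_add₀ hq.ne']; simp
        _ ≤ _ := by gcongr
    -- translating the ball by `y₀` multiplies the integral by `χ x ≠ 1`
    have key : ∫ y in B, (χ (u * y) : ℂ) ∂m = (χ x : ℂ) * ∫ y in B, (χ (u * y) : ℂ) ∂m := by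
      rw [← integral_const_mul, ← integral_indicator measurableSet_closedBall,
        ← integral_indicator measurableSet_closedBall,
        ← integral_add_left_eq_self (μ := m) _ y₀]
      congr 1
      ext y
      have hmem : y₀ + y ∈ B ↔ y ∈ B := by
        rw [hB, mem_closedBall_zero_iff, mem_closedBall_zero_iff]
        constructor
        · intro h
          have := IsUltrametricDist.norm_add_le_max (y₀ + y) (-y₀)
          rw [add_neg_cancel_comm, norm_neg] at this
          exact this.trans (max_le h hy₀B)
        · intro h
          exact (IsUltrametricDist.norm_add_le_max _ _).trans (max_le hy₀B h)
      by_cases hy : y ∈ B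
      · rw [Set.indicator_of_mem (hmem.2 hy), Set.indicator_of_mem hy, mul_add, hy₀,
          mul_inv_cancel_left₀ (norm_pos_iff.1 hu0), AddChar.map_add_eq_mul, Circle.coe_mul]
      · rw [Set.indicator_of_notMem (hmem.not.2 hy), Set.indicator_of_notMem hy]
    have h1 : (1 - (χ x : ℂ)) * ∫ y in B, (χ (u * y) : ℂ) ∂m = 0 := by
      rw [sub_mul, one_mul, ← key, sub_self]
    refine (mul_eq_zero.1 h1).resolve_left ?_
    intro h
    exact hx1 (Circle.ext (sub_eq_zero.1 h).symm)

end LocalField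

/-! ### Plancherel's formula for an indicator function -/

section Plancherel

variable {F : Type*} [NontriviallyNormedField F] [IsUltrametricDist F] [LocallyCompactSpace F]
  [MeasurableSpace F] [BorelSpace F] (m : Measure F)

lemma charFourier_indicator {F : Type*} [Field F] [MeasurableSpace F] (χ : AddChar F Circle)
    (m : Measure F) {S : Set F} (hS : MeasurableSet S) (y : F) :
    charFourier χ m (S.indicator 1) y = ∫ x in S, (χ (x * y) : ℂ) ∂m := by
  rw [charFourier, ← integral_indicator hS]
  congr 1
  ext x
  by_cases hx : x ∈ S <;> simp [hx]

lemma charFourier_indicator_zero {F : Type*} [Field F] [MeasurableSpace F] (χ : AddChar F Circle)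
    (m : Measure F) {S : Set F} (hS : MeasurableSet S) :
    charFourier χ m (S.indicator 1) 0 = (m.real S : ℂ) := by
  rw [charFourier_indicator χ m hS]
  simp

lemma charFourier_indicator_neg {F : Type*} [Field F] [MeasurableSpace F] (χ : AddChar F Circle)
    (m : Measure F) {S : Set F} (hS : MeasurableSet S) (y : F) :
    charFourier χ m (S.indicator 1) (-y) =
      (starRingEnd ℂ) (charFourier χ m (S.indicator 1) y) := by
  rw [charFourier_indicator χ m hS, charFourier_indicator χ m hS, ← integral_conj]
  congr 1
  ext x
  rw [mul_neg, AddChar.map_neg_eq_inv, Circle.coe_inv_eq_conj]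

lemma continuous_charFourier_indicator (χ : AddChar F Circle) (hχ : Continuous χ)
    {S : Set F} (hS : MeasurableSet S) (hS_fin : m S < ⊤) :
    Continuous (charFourier χ m (S.indicator 1)) := by
  have : ProperSpace F := .of_nontriviallyNormedField_of_weaklyLocallyCompactSpace F
  have : IsFiniteMeasure (m.restrict S) := ⟨by simpa using hS_fin⟩
  have h : charFourier χ m (S.indicator 1) = fun y => ∫ x in S, (χ (x * y) : ℂ) ∂m :=
    funext fun y => charFourier_indicator χ m hS y
  rw [h]
  refine continuous_of_dominated (bound := fun _ => 1) ?_ ?_ (integrable_const _) ?_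
  · intro y
    exact Continuous.aestronglyMeasurable (by fun_prop)
  · intro y
    exact Eventually.of_forall fun x => (Circle.norm_coe _).le
  · exact Eventually.of_forall fun x => by fun_prop

variable [m.IsAddHaarMeasure]

/-- The pairs of points of `S` at distance at most `r`. -/
def closePairs (S : Set F) (r : ℝ) : Set (F × F) :=
  {p | p.1 ∈ S ∧ p.2 ∈ S ∧ ‖p.1 - p.2‖ ≤ r}

/-- By Fubini, the integral is that over `(x, x') ∈ S × S` of the integrals of
`y ↦ χ ((x - x') * y)` over the ball, which orthogonality of characters evaluates. -/
lemma setIntegral_norm_charFourier_sq (hF : IsStandardNorm F) (hm : m (closedBall 0 1) = 1)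
    (χ : AddChar F Circle) (hχ : Continuous χ) (hχ_one : ∀ x : F, ‖x‖ ≤ 1 → χ x = 1)
    (hχ_ne : ∃ x : F, ‖x‖ ≤ (residueCard F : ℝ) ∧ χ x ≠ 1)
    {S : Set F} (hS : MeasurableSet S) (hS_fin : m S < ⊤) (j : ℤ) :
    ∫ y in closedBall (0 : F) ((residueCard F : ℝ) ^ j),
        ‖charFourier χ m (S.indicator 1) y‖ ^ 2 ∂m =
      (residueCard F : ℝ) ^ j * (m.prod m).real (closePairs S ((residueCard F : ℝ) ^ (-j))) := by
  have : ProperSpace F := .of_nontriviallyNormedField_of_weaklyLocallyCompactSpace F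
  have : IsFiniteMeasure (m.restrict S) := ⟨by simpa using hS_fin⟩
  set B := closedBall (0 : F) ((residueCard F : ℝ) ^ j)
  have : IsFiniteMeasure (m.restrict B) :=
    ⟨by simpa using (isCompact_closedBall (0 : F) _).measure_lt_top⟩
  set μ := m.restrict S
  have h1 : ∀ y : F, ((‖charFourier χ m (S.indicator 1) y‖ ^ 2 : ℝ) : ℂ) =
      ∫ p : F × F, (χ ((p.1 - p.2) * y) : ℂ) ∂(μ.prod μ) := by
    intro y
    rw [Complex.ofReal_pow, ← Complex.mul_conj', ← charFourier_indicator_neg χ m hS,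
      charFourier_indicator χ m hS, charFourier_indicator χ m hS, ← integral_prod_mul]
    congr 1
    ext p
    rw [← Circle.coe_mul, ← AddChar.map_add_eq_mul]
    ring_nf
  have hclosed : MeasurableSet {p : F × F | ‖p.1 - p.2‖ ≤ (residueCard F : ℝ) ^ (-j)} :=
    (isClosed_le (by fun_prop) continuous_const).measurableSet
  rw [← Complex.ofReal_inj, ← integral_complex_ofReal]
  simp only [h1]
  rw [integral_integral_swap]
  · have h2 : ∀ p : F × F, ∫ y in B, (χ ((p.1 - p.2) * y) : ℂ) ∂m =
        {p : F × F | ‖p.1 - p.2‖ ≤ (residueCard F : ℝ) ^ (-j)}.indicator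
          (fun _ => ((residueCard F : ℝ) ^ j : ℂ)) p := by
      intro p
      rw [setIntegral_addChar_closedBall m hF hm χ hχ_one hχ_ne]
      by_cases hp : ‖p.1 - p.2‖ ≤ (residueCard F : ℝ) ^ (-j)
      · rw [Set.indicator_of_mem (by simpa using hp), Set.indicator_of_mem (by simpa using hp)]
      · rw [Set.indicator_of_notMem (by simpa using hp), Set.indicator_of_notMem (by simpa using hp)]
    simp only [h2]
    rw [integral_indicator hclosed, setIntegral_const, measureReal_def, Measure.prod_restrict,
      Measure.restrict_apply hclosed, measureReal_def]
    have : {p : F × F | ‖p.1 - p.2‖ ≤ (residueCard F : ℝ) ^ (-j)} ∩ S ×ˢ S =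
        closePairs S ((residueCard F : ℝ) ^ (-j)) := by
      ext p
      simp only [closePairs, Set.mem_inter_iff, Set.mem_ofPred_eq, Set.mem_prod]
      tauto
    rw [this]
    push_cast
    rw [Complex.real_smul, mul_comm]
  · refine Integrable.of_bound (C := 1) (Continuous.aestronglyMeasurable ?_)
      (Eventually.of_forall fun p => (Circle.norm_coe _).le)
    unfold Function.uncurry
    fun_prop

lemma prod_strip_fst (hF : IsStandardNorm F) (hm : m (closedBall 0 1) = 1) {A : Set F}
    (hA : MeasurableSet A) (j : ℤ) :
    (m.prod m) {p : F × F | p.1 ∈ A ∧ ‖p.1 - p.2‖ ≤ (residueCard F : ℝ) ^ j} =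
      (residueCard F : ENNReal) ^ j * m A := by
  have : ProperSpace F := .of_nontriviallyNormedField_of_weaklyLocallyCompactSpace F
  have hclosed : MeasurableSet {p : F × F | ‖p.1 - p.2‖ ≤ (residueCard F : ℝ) ^ j} :=
    (isClosed_le (by fun_prop) continuous_const).measurableSet
  refine (Measure.prod_apply ((measurable_fst hA).inter hclosed)).trans ?_
  have : ∀ x : F, m (Prod.mk x ⁻¹'
      {p : F × F | p.1 ∈ A ∧ ‖p.1 - p.2‖ ≤ (residueCard F : ℝ) ^ j}) =
      A.indicator (fun _ => (residueCard F : ENNReal) ^ j) x := by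
    intro x
    by_cases hx : x ∈ A
    · rw [Set.indicator_of_mem hx, ← measure_closedBall_zpow m hF hm x j]
      congr 1
      ext y
      simp [hx, dist_eq_norm, norm_sub_rev]
    · rw [Set.indicator_of_notMem hx]
      simp [hx]
  have h2 := lintegral_congr (μ := m) this
  refine h2.trans ?_
  rw [lintegral_indicator hA, setLIntegral_const]

lemma prod_strip_snd (hF : IsStandardNorm F) (hm : m (closedBall 0 1) = 1) {A : Set F}
    (hA : MeasurableSet A) (j : ℤ) :
    (m.prod m) {p : F × F | p.2 ∈ A ∧ ‖p.1 - p.2‖ ≤ (residueCard F : ℝ) ^ j} =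
      (residueCard F : ENNReal) ^ j * m A := by
  have : ProperSpace F := .of_nontriviallyNormedField_of_weaklyLocallyCompactSpace F
  have hclosed : MeasurableSet {p : F × F | ‖p.1 - p.2‖ ≤ (residueCard F : ℝ) ^ j} :=
    (isClosed_le (by fun_prop) continuous_const).measurableSet
  rw [← prod_strip_fst m hF hm hA]
  have h := (Measure.measurePreserving_swap (μ := m) (ν := m)).measure_preimage
    ((measurable_fst hA).inter hclosed).nullMeasurableSet
  refine Eq.trans ?_ h
  congr 1
  ext p
  simp [norm_sub_rev]

lemma setIntegral_norm_charFourier_sq_le (hF : IsStandardNorm F) (hm : m (closedBall 0 1) = 1)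
    (χ : AddChar F Circle) (hχ : Continuous χ) (hχ_one : ∀ x : F, ‖x‖ ≤ 1 → χ x = 1)
    (hχ_ne : ∃ x : F, ‖x‖ ≤ (residueCard F : ℝ) ∧ χ x ≠ 1)
    {S : Set F} (hS : MeasurableSet S) (hS_fin : m S < ⊤) (j : ℤ) :
    ∫ y in closedBall (0 : F) ((residueCard F : ℝ) ^ j),
        ‖charFourier χ m (S.indicator 1) y‖ ^ 2 ∂m ≤ m.real S := by
  have hq : (0 : ℝ) < residueCard F := by linarith [one_lt_residueCard hF]
  rw [setIntegral_norm_charFourier_sq m hF hm χ hχ hχ_one hχ_ne hS hS_fin]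
  have hfin : (m.prod m) {p : F × F | p.1 ∈ S ∧ ‖p.1 - p.2‖ ≤ (residueCard F : ℝ) ^ (-j)} ≠ ⊤ := by
    rw [prod_strip_fst m hF hm hS]
    refine ENNReal.mul_ne_top ?_ hS_fin.ne
    exact ENNReal.zpow_ne_top (by exact_mod_cast residueCard_ne_zero hF) (by simp) _
  have h1 : (m.prod m).real (closePairs S ((residueCard F : ℝ) ^ (-j))) ≤
      (m.prod m).real {p : F × F | p.1 ∈ S ∧ ‖p.1 - p.2‖ ≤ (residueCard F : ℝ) ^ (-j)} :=
    measureReal_mono (fun p hp => ⟨hp.1, hp.2.2⟩) hfin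
  have h2 : (m.prod m).real {p : F × F | p.1 ∈ S ∧ ‖p.1 - p.2‖ ≤ (residueCard F : ℝ) ^ (-j)} =
      (residueCard F : ℝ) ^ (-j) * m.real S := by
    rw [measureReal_def, prod_strip_fst m hF hm hS, ENNReal.toReal_mul,
      ← measure_closedBall_zpow m hF hm 0, ← measureReal_def, measureReal_closedBall_zpow m hF hm,
      measureReal_def]
  calc _ ≤ (residueCard F : ℝ) ^ j * ((residueCard F : ℝ) ^ (-j) * m.real S) := by
        rw [← h2]; gcongr
    _ = m.real S := by rw [← mul_assoc, ← zpow_add₀ hq.ne']; simp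

/-- If `K ⊆ S` is compact and `U ⊇ K` is open, then for small `r` every point within distance `r`
of a point of `K` lies in `K` or in `U \ K`. So the strip of width `r` around the diagonal of `K` is
covered by the close pairs of `S` and the pairs with second coordinate in `U \ K`. -/
lemma eventually_measure_compact_le (hF : IsStandardNorm F) (hm : m (closedBall 0 1) = 1)
    (χ : AddChar F Circle) (hχ : Continuous χ) (hχ_one : ∀ x : F, ‖x‖ ≤ 1 → χ x = 1)
    (hχ_ne : ∃ x : F, ‖x‖ ≤ (residueCard F : ℝ) ∧ χ x ≠ 1)
    {S : Set F} (hS : MeasurableSet S) (hS_fin : m S < ⊤) {K U : Set F} (hK : IsCompact K)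
    (hKS : K ⊆ S) (hU : IsOpen U) (hKU : K ⊆ U) (hU_fin : m U ≠ ⊤) :
    ∀ᶠ j : ℕ in atTop, m.real K ≤ (∫ y in closedBall (0 : F) ((residueCard F : ℝ) ^ j),
        ‖charFourier χ m (S.indicator 1) y‖ ^ 2 ∂m) + m.real (U \ K) := by
  have hq1 := one_lt_residueCard hF
  have hq : (0 : ℝ) < residueCard F := by linarith
  obtain ⟨δ, hδ, hδU⟩ := hK.exists_thickening_subset_open hU hKU
  have hlim : Tendsto (fun j : ℕ => ((residueCard F : ℝ) ^ j)⁻¹) atTop (nhds 0) :=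
    (tendsto_pow_atTop_atTop_of_one_lt hq1).inv_tendsto_atTop
  filter_upwards [hlim.eventually_lt_const hδ] with j hj
  have hj' : (residueCard F : ℝ) ^ (-(j : ℤ)) < δ := by rwa [zpow_neg, zpow_natCast]
  have h0 := setIntegral_norm_charFourier_sq m hF hm χ hχ hχ_one hχ_ne hS hS_fin (j : ℤ)
  rw [zpow_natCast] at h0
  rw [h0]
  set r := (residueCard F : ℝ) ^ (-(j : ℤ)) with hr
  have hstrip : ∀ A : Set F, MeasurableSet A → m A ≠ ⊤ →
      (m.prod m) {p : F × F | p.1 ∈ A ∧ ‖p.1 - p.2‖ ≤ r} ≠ ⊤ := by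
    intro A hA hAf
    rw [prod_strip_fst m hF hm hA]
    refine ENNReal.mul_ne_top ?_ hAf
    exact ENNReal.zpow_ne_top (by exact_mod_cast residueCard_ne_zero hF) (by simp) _
  have hclose : (m.prod m) (closePairs S r) ≠ ⊤ :=
    measure_ne_top_of_subset
      (show closePairs S r ⊆ {p : F × F | p.1 ∈ S ∧ ‖p.1 - p.2‖ ≤ r} from
        fun p hp => ⟨hp.1, hp.2.2⟩)
      (hstrip S hS hS_fin.ne)
  have hUK : MeasurableSet (U \ K) := hU.measurableSet.diff hK.measurableSet
  have hUKf : m (U \ K) ≠ ⊤ := measure_ne_top_of_subset Set.sdiff_subset hU_fin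
  have hval : ((residueCard F : ENNReal) ^ (-(j : ℤ))).toReal = r := by
    rw [← measure_closedBall_zpow m hF hm 0, ← measureReal_def, measureReal_closedBall_zpow m hF hm]
  have h1 : (m.prod m).real {p : F × F | p.1 ∈ K ∧ ‖p.1 - p.2‖ ≤ r} = r * m.real K := by
    rw [measureReal_def, prod_strip_fst m hF hm hK.measurableSet, ENNReal.toReal_mul, hval,
      measureReal_def]
  have h2 : (m.prod m).real {p : F × F | p.2 ∈ U \ K ∧ ‖p.1 - p.2‖ ≤ r} = r * m.real (U \ K) := by
    rw [measureReal_def, prod_strip_snd m hF hm hUK, ENNReal.toReal_mul, hval, measureReal_def]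
  have hsub : {p : F × F | p.1 ∈ K ∧ ‖p.1 - p.2‖ ≤ r} ⊆
      closePairs S r ∪ {p : F × F | p.2 ∈ U \ K ∧ ‖p.1 - p.2‖ ≤ r} := by
    rintro p ⟨hp, hpr⟩
    by_cases hp2 : p.2 ∈ K
    · exact Or.inl ⟨hKS hp, hKS hp2, hpr⟩
    · refine Or.inr ⟨⟨hδU ?_, hp2⟩, hpr⟩
      rw [mem_thickening_iff]
      refine ⟨p.1, hp, ?_⟩
      rw [dist_comm, dist_eq_norm]
      exact hpr.trans_lt hj'
  have h3 : r * m.real K ≤ (m.prod m).real (closePairs S r) + r * m.real (U \ K) := by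
    rw [← h1, ← h2]
    refine (measureReal_mono hsub (measure_union_ne_top hclose ?_)).trans
      (measureReal_union_le _ _)
    rw [prod_strip_snd m hF hm hUK, ← prod_strip_fst m hF hm hUK]
    exact hstrip _ hUK hUKf
  have hr0 : 0 < r := zpow_pos hq _
  have hqr : (residueCard F : ℝ) ^ (j : ℤ) = r⁻¹ := by rw [hr, zpow_neg, inv_inv]
  rw [← zpow_natCast, hqr]
  have h4 := mul_le_mul_of_nonneg_left h3 (inv_pos.2 hr0).le
  rwa [mul_add, inv_mul_cancel_left₀ hr0.ne', inv_mul_cancel_left₀ hr0.ne'] at h4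

/-- Plancherel's formula for the indicator function of `S`, in the form of a limit over balls. -/
lemma tendsto_setIntegral_norm_charFourier_sq (hF : IsStandardNorm F)
    (hm : m (closedBall 0 1) = 1)
    (χ : AddChar F Circle) (hχ : Continuous χ) (hχ_one : ∀ x : F, ‖x‖ ≤ 1 → χ x = 1)
    (hχ_ne : ∃ x : F, ‖x‖ ≤ (residueCard F : ℝ) ∧ χ x ≠ 1)
    {S : Set F} (hS : MeasurableSet S) (hS_fin : m S < ⊤) :
    Tendsto (fun j : ℕ => ∫ y in closedBall (0 : F) ((residueCard F : ℝ) ^ j),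
        ‖charFourier χ m (S.indicator 1) y‖ ^ 2 ∂m) atTop (nhds (m.real S)) := by
  have : ProperSpace F := .of_nontriviallyNormedField_of_weaklyLocallyCompactSpace F
  rw [Metric.tendsto_nhds]
  intro ε hε
  have hε' : ENNReal.ofReal (ε / 2) ≠ 0 := by simpa using hε
  obtain ⟨K, hKS, hK, hKm⟩ := hS.exists_isCompact_lt_add hS_fin.ne hε'
  have hKf : m K ≠ ⊤ := hK.measure_lt_top.ne
  obtain ⟨U, hKU, hU, hUm⟩ := K.exists_isOpen_lt_add hKf hε'
  have hUf : m U ≠ ⊤ := ne_top_of_lt hUm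
  have hSK : m.real S < m.real K + ε / 2 := by
    have := (ENNReal.toReal_lt_toReal hS_fin.ne (by finiteness)).2 hKm
    rwa [ENNReal.toReal_add hKf (by finiteness), ENNReal.toReal_ofReal (by positivity)] at this
  have hUK : m.real (U \ K) < ε / 2 := by
    have := (ENNReal.toReal_lt_toReal hUf (by finiteness)).2 hUm
    rw [ENNReal.toReal_add hKf (by finiteness), ENNReal.toReal_ofReal (by positivity)] at this
    rw [measureReal_sdiff hKU hK.measurableSet hUf, measureReal_def, measureReal_def]
    linarith
  filter_upwards [eventually_measure_compact_le m hF hm χ hχ hχ_one hχ_ne hS hS_fin hK hKS hU hKU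
    hUf] with j hj
  have hle := setIntegral_norm_charFourier_sq_le m hF hm χ hχ hχ_one hχ_ne hS hS_fin (j : ℤ)
  rw [zpow_natCast] at hle
  rw [Real.dist_eq, abs_lt]
  constructor <;> linarith

/-- The mass of `|f̂|²`, for `f` the indicator function of `S`, outside the ball of radius `q ^ j`
is what is missing from `m(S)` inside that ball. -/
lemma setIntegral_compl_norm_charFourier_sq (hF : IsStandardNorm F)
    (hm : m (closedBall 0 1) = 1)
    (χ : AddChar F Circle) (hχ : Continuous χ) (hχ_one : ∀ x : F, ‖x‖ ≤ 1 → χ x = 1)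
    (hχ_ne : ∃ x : F, ‖x‖ ≤ (residueCard F : ℝ) ∧ χ x ≠ 1)
    {S : Set F} (hS : MeasurableSet S) (hS_fin : m S < ⊤) (j : ℕ) :
    ∫ y in (closedBall (0 : F) ((residueCard F : ℝ) ^ j))ᶜ,
        ‖charFourier χ m (S.indicator 1) y‖ ^ 2 ∂m =
      m.real S - ∫ y in closedBall (0 : F) ((residueCard F : ℝ) ^ j),
        ‖charFourier χ m (S.indicator 1) y‖ ^ 2 ∂m := by
  have : ProperSpace F := .of_nontriviallyNormedField_of_weaklyLocallyCompactSpace F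
  have hlim := tendsto_setIntegral_norm_charFourier_sq m hF hm χ hχ hχ_one hχ_ne hS hS_fin
  have hcont : Continuous fun y => ‖charFourier χ m (S.indicator 1) y‖ ^ 2 :=
    (continuous_charFourier_indicator m χ hχ hS hS_fin).norm.pow 2
  have hcover : AECover m atTop
      (fun j : ℕ => closedBall (0 : F) ((residueCard F : ℝ) ^ j)) :=
    aecover_closedBall (tendsto_pow_atTop_atTop_of_one_lt (one_lt_residueCard hF))
  have hint : Integrable (fun y => ‖charFourier χ m (S.indicator 1) y‖ ^ 2) m := by
    refine hcover.integrable_of_integral_bounded_of_nonneg_ae (m.real S)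
      (fun j => hcont.continuousOn.integrableOn_compact (isCompact_closedBall _ _))
      (Eventually.of_forall fun y => by positivity) (Eventually.of_forall fun j => ?_)
    have hle := setIntegral_norm_charFourier_sq_le m hF hm χ hχ hχ_one hχ_ne hS hS_fin (j : ℤ)
    rwa [zpow_natCast] at hle
  have htot := tendsto_nhds_unique (hcover.integral_tendsto_of_countably_generated hint) hlim
  rw [← htot, ← integral_add_compl (measurableSet_closedBall (x := (0 : F))) hint, add_sub_cancel_left]

end Plancherel

/-! ### Averages of weakly correlated random variables -/

section WeakCorrelation

variable {Ω : Type*} [MeasurableSpace Ω] {P : Measure Ω}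

/-- Exponentially decaying covariances make the second moment of the partial sums grow at most
linearly. -/
lemma integral_sum_sq_le {Y : ℕ → Ω → ℝ} (hY : ∀ i, MemLp (Y i) 2 P) {C r : ℝ} (hC : 0 ≤ C)
    (hr0 : 0 ≤ r) (hr1 : r < 1) (hcov : ∀ i d, ∫ ω, Y i ω * Y (i + d) ω ∂P ≤ C * r ^ d) (k : ℕ) :
    ∫ ω, (∑ i ∈ Finset.range k, Y i ω) ^ 2 ∂P ≤ k * (2 * C * (1 - r)⁻¹ + C) := by
  induction k with
  | zero => simp
  | succ k ih =>
    have hint : ∀ i j, Integrable (fun ω => Y i ω * Y j ω) P :=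
      fun i j => (hY i).integrable_mul (hY j)
    have hsum : MemLp (fun ω => ∑ i ∈ Finset.range k, Y i ω) 2 P :=
      memLp_finsetSum _ fun i _ => hY i
    have h1 : ∀ ω, (∑ i ∈ Finset.range (k + 1), Y i ω) ^ 2 =
        (∑ i ∈ Finset.range k, Y i ω) ^ 2 + 2 * (∑ i ∈ Finset.range k, Y i ω * Y k ω) +
          Y k ω * Y k ω := by
      intro ω
      rw [Finset.sum_range_succ, ← Finset.sum_mul]
      ring
    simp only [h1]
    have hcross : Integrable (fun ω => 2 * ∑ i ∈ Finset.range k, Y i ω * Y k ω) P :=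
      (integrable_finsetSum _ fun i _ => hint i k).const_mul 2
    have hsq := hsum.integrable_sq
    have hsq' : Integrable (fun ω => (∑ i ∈ Finset.range k, Y i ω) ^ 2 +
        2 * ∑ i ∈ Finset.range k, Y i ω * Y k ω) P := hsq.add hcross
    rw [integral_add hsq' (hint k k), integral_add hsq hcross, integral_const_mul,
      integral_finsetSum _ fun i _ => hint i k]
    -- the exponent is lowered from `k - i` to `k - 1 - i` so that reflecting the sum gives `r ^ i`
    have h2 : ∑ i ∈ Finset.range k, ∫ ω, Y i ω * Y k ω ∂P ≤ C * (1 - r)⁻¹ := by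
      calc _ ≤ ∑ i ∈ Finset.range k, C * r ^ (k - 1 - i) := by
            refine Finset.sum_le_sum fun i hi => ?_
            have hik : i < k := Finset.mem_range.1 hi
            have := hcov i (k - i)
            rw [Nat.add_sub_cancel' hik.le] at this
            exact this.trans (mul_le_mul_of_nonneg_left
              (pow_le_pow_of_le_one hr0 hr1.le (by omega)) hC)
        _ = C * ∑ i ∈ Finset.range k, r ^ i := by
            rw [← Finset.mul_sum, Finset.sum_range_reflect (fun i => r ^ i)]
        _ ≤ C * (1 - r)⁻¹ := by
            gcongr
            rw [← tsum_geometric_of_lt_one hr0 hr1]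
            exact (summable_geometric_of_lt_one hr0 hr1).sum_le_tsum _ fun i _ => by positivity
    have h3 := hcov k 0
    rw [add_zero, pow_zero, mul_one] at h3
    push_cast
    linarith

/-- A weak law of large numbers, along a subsequence almost surely. -/
lemma exists_seq_tendsto_average {Y : ℕ → Ω → ℝ} (hY : ∀ i, MemLp (Y i) 2 P) {C r : ℝ}
    (hC : 0 ≤ C) (hr0 : 0 ≤ r) (hr1 : r < 1)
    (hcov : ∀ i d, ∫ ω, Y i ω * Y (i + d) ω ∂P ≤ C * r ^ d) :
    ∃ ns : ℕ → ℕ, StrictMono ns ∧ ∀ᵐ ω ∂P,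
      Tendsto (fun l => (ns l : ℝ)⁻¹ * ∑ i ∈ Finset.range (ns l), Y i ω) atTop (nhds 0) := by
  set T : ℕ → Ω → ℝ := fun (k : ℕ) ω => ((k : ℝ)⁻¹ * ∑ i ∈ Finset.range k, Y i ω) ^ 2 with hT
  have hsum : ∀ k : ℕ, MemLp (fun ω => (k : ℝ)⁻¹ * ∑ i ∈ Finset.range k, Y i ω) 2 P :=
    fun k => (memLp_finsetSum _ fun i _ => hY i).const_mul _
  have hTint : ∀ k, Integrable (T k) P := fun k => (hsum k).integrable_sq
  set C' := 2 * C * (1 - r)⁻¹ + C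
  have hle : ∀ k : ℕ, ∫ ω, T k ω ∂P ≤ (k : ℝ)⁻¹ * C' := by
    intro k
    simp only [hT, mul_pow]
    rw [integral_const_mul]
    rcases Nat.eq_zero_or_pos k with rfl | hk
    · simp
    · have hk' : (0 : ℝ) < k := by exact_mod_cast hk
      calc _ ≤ (k : ℝ)⁻¹ ^ 2 * (k * C') := by
            gcongr; exact integral_sum_sq_le hY hC hr0 hr1 hcov k
        _ = _ := by field_simp
  have hlim : Tendsto (fun k => ∫ ω, T k ω ∂P) atTop (nhds 0) := by
    refine squeeze_zero (fun k => integral_nonneg fun ω => by simp only [hT]; positivity) hle ?_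
    simpa using (tendsto_inv_atTop_nhds_zero_nat (𝕜 := ℝ)).mul_const C'
  have hmeas : TendstoInMeasure P T atTop (fun _ => 0) := by
    refine tendstoInMeasure_of_tendsto_eLpNorm (p := 1) one_ne_zero
      (fun k => (hTint k).aestronglyMeasurable) aestronglyMeasurable_const ?_
    have : ∀ k, eLpNorm (T k - fun _ => 0) 1 P = ENNReal.ofReal (∫ ω, T k ω ∂P) := by
      intro k
      rw [show (T k - fun _ => 0) = T k from sub_zero _, eLpNorm_one_eq_lintegral_enorm,
        ← ofReal_integral_norm_eq_lintegral_enorm (hTint k)]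
      congr 2
      ext ω
      exact Real.norm_of_nonneg (by simp only [hT]; positivity)
    simp only [this]
    simpa using ENNReal.tendsto_ofReal hlim
  obtain ⟨ns, hns, hae⟩ := hmeas.exists_seq_tendsto_ae
  refine ⟨ns, hns, ?_⟩
  filter_upwards [hae] with ω hω
  have h := (Real.continuous_sqrt.tendsto 0).comp hω
  rw [Real.sqrt_zero] at h
  rw [tendsto_zero_iff_abs_tendsto_zero]
  refine h.congr fun l => ?_
  simp only [hT, Function.comp]
  rw [Real.sqrt_sq_eq_abs]

end WeakCorrelation

/-! ### Particle counts inside and outside a set -/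

namespace Configuration

variable {F : Type*} [PseudoMetricSpace F]

lemma measurable_count [MeasurableSpace F] {B : Set F} (hB : MeasurableSet B)
    (hb : Bornology.IsBounded B) : Measurable (count B) := by
  rw [measurable_iff_comap_le]
  exact le_iSup (fun B : {B : Set F // MeasurableSet B ∧ Bornology.IsBounded B} =>
    MeasurableSpace.comap (count B.1) ⊤) ⟨B, hB, hb⟩

lemma count_eq_count_add_count_outside {B D : Set F} (hBD : B ⊆ D) (hD : Bornology.IsBounded D)
    (s : Configuration F) : count D s = count B s + count D (outside B s) := by
  have h : s.1 ∩ D = (s.1 ∩ B) ∪ ((s.1 \ B) ∩ D) := by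
    ext x
    simp only [Set.mem_inter_iff, Set.mem_union, Set.mem_sdiff]
    have := @hBD x
    tauto
  unfold count outside
  have hdisj : Disjoint (s.1 ∩ B) ((s.1 \ B) ∩ D) := by
    rw [Set.disjoint_left]
    rintro x ⟨-, hx⟩ ⟨⟨-, hx'⟩, -⟩
    exact hx' hx
  rw [h, Set.ncard_union_eq hdisj (s.2 B (hD.subset hBD))
    ((s.2 D hD).subset (Set.inter_subset_inter_left _ Set.sdiff_subset))]

end Configuration

open Configuration in
/-- If the average fluctuation of the counts in bounded sets containing `B` tends to `0`, the number
of particles in `B` is recovered from the outside as minus the limit of the average fluctuation of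
the counts of the outside configuration. -/
lemma exists_measurable_count_eq {F Ω : Type*} [PseudoMetricSpace F] [MeasurableSpace F]
    [MeasurableSpace Ω] {P : Measure Ω} {X : Ω → Configuration F} {B : Set F} {D : ℕ → Set F}
    (hBD : ∀ j, B ⊆ D j) (hD : ∀ j, MeasurableSet (D j)) (hDb : ∀ j, Bornology.IsBounded (D j))
    {e : ℕ → ℝ} {ns : ℕ → ℕ} (hns : StrictMono ns)
    (h : ∀ᵐ ω ∂P, Tendsto (fun l => (ns l : ℝ)⁻¹ *
      ∑ i ∈ Finset.range (ns l), ((count (D i) (X ω) : ℝ) - e i)) atTop (nhds 0)) :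
    ∃ f : Configuration F → ℕ, Measurable f ∧ ∀ᵐ ω ∂P, (X ω).count B = f ((X ω).outside B) := by
  set a : ℕ → Configuration F → ℝ := fun l s =>
    -((ns l : ℝ)⁻¹ * ∑ i ∈ Finset.range (ns l), ((count (D i) s : ℝ) - e i)) with ha
  have ham : ∀ l, Measurable (a l) := by
    intro l
    refine Measurable.neg (Measurable.const_mul (Finset.measurable_fun_sum _ fun i _ => ?_) _)
    exact (measurable_from_nat.comp (measurable_count (hD i) (hDb i))).sub_const _
  -- the limit is a natural number almost surely; elsewhere the value of `f` is irrelevant, and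
  -- `limsup` and floor are used because they are measurable
  refine ⟨fun s => ⌊limsup (fun l => a l s) atTop⌋₊,
    Nat.measurable_floor.comp (Measurable.limsup ham), ?_⟩
  filter_upwards [h] with ω hω
  have hlim : Tendsto (fun l => a l ((X ω).outside B)) atTop (nhds ((X ω).count B : ℝ)) := by
    have h1 := tendsto_const_nhds (x := ((X ω).count B : ℝ)).sub hω
    rw [sub_zero] at h1
    refine h1.congr' ?_
    filter_upwards [eventually_ge_atTop 1] with l hl
    have hpos : (ns l : ℝ) ≠ 0 := by
      have := hns.le_apply (x := l)
      exact_mod_cast (by omega : ns l ≠ 0)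
    have h2 : ∀ i, ((count (D i) (X ω) : ℝ) - e i) =
        count B (X ω) + ((count (D i) ((X ω).outside B) : ℝ) - e i) := by
      intro i
      rw [count_eq_count_add_count_outside (hBD i) (hDb i)]
      push_cast
      ring
    simp only [ha, h2]
    rw [Finset.sum_add_distrib, Finset.sum_const, Finset.card_range, nsmul_eq_mul, mul_add,
      inv_mul_cancel_left₀ hpos]
    ring
  rw [hlim.limsup_eq, Nat.floor_natCast]

/-! ### Sums over tuples of distinct particles -/

lemma finsum_mem_indicator_one {α : Type*} (T U : Set α) (h : (T ∩ U).Finite) :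
    ∑ᶠ x ∈ T, U.indicator (1 : α → ℂ) x = ((T ∩ U).ncard : ℂ) := by
  have h1 : ∑ᶠ x ∈ T, U.indicator (1 : α → ℂ) x = ∑ᶠ x ∈ T ∩ U, (1 : ℂ) := by
    rw [finsum_mem_def, finsum_mem_def]
    congr 1
    ext x
    rw [Set.indicator_indicator]
    rfl
  rw [h1, finsum_mem_eq_finite_toFinset_sum _ h, Set.ncard_eq_toFinset_card _ h]
  simp

namespace Configuration

variable {F : Type*} [PseudoMetricSpace F]

lemma tupleSum_indicator_one {B : Set F} (hB : Bornology.IsBounded B) (s : Configuration F) :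
    s.tupleSum ((Set.univ.pi fun _ : Fin 1 => B).indicator 1) = (count B s : ℂ) := by
  have h : {x : Fin 1 → F | Function.Injective x ∧ ∀ i, x i ∈ s.1} ∩ (Set.univ.pi fun _ => B) =
      Equiv.funUnique (Fin 1) F ⁻¹' (s.1 ∩ B) := by
    ext x
    simp [Function.injective_of_subsingleton]
  rw [tupleSum, finsum_mem_indicator_one, h]
  · rw [count, ← Set.ncard_preimage_of_injective_subset_range (Equiv.funUnique (Fin 1) F).injective
      ((Equiv.surjective _).range_eq ▸ Set.subset_univ _)]
  · rw [h]
    exact (s.2 B hB).preimage (Equiv.injective _).injOn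

/-- The pairs in `A × B` of distinct particles are all pairs except those on the diagonal, of which
there are `count A s` because `A ⊆ B`. -/
lemma tupleSum_indicator_two {A B : Set F} (hAB : A ⊆ B) (hB : Bornology.IsBounded B)
    (s : Configuration F) :
    s.tupleSum ((Set.univ.pi ![A, B]).indicator 1) =
      (count A s : ℂ) * count B s - count A s := by
  have hBf := s.2 B hB
  have hAf := s.2 A (hB.subset hAB)
  set D : Set (F × F) := (fun x => (x, x)) '' (s.1 ∩ A) with hD
  have h : {x : Fin 2 → F | Function.Injective x ∧ ∀ i, x i ∈ s.1} ∩ (Set.univ.pi ![A, B]) =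
      finTwoArrowEquiv F ⁻¹' (((s.1 ∩ A) ×ˢ (s.1 ∩ B)) \ D) := by
    ext x
    have hinj : Function.Injective x ↔ x 0 ≠ x 1 := by
      constructor
      · intro h h01
        exact absurd (h h01) (by decide)
      · intro h i j hij
        fin_cases i <;> fin_cases j <;> simp_all [eq_comm]
    simp only [Set.mem_inter_iff, Set.mem_ofPred_eq, Set.mem_univ_pi, Fin.forall_fin_two, hinj,
      Set.mem_preimage, Set.mem_sdiff, Set.mem_prod, hD, Set.mem_image, finTwoArrowEquiv_apply,
      Prod.ext_iff, Matrix.cons_val_zero, Matrix.cons_val_one, not_exists, not_and]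
    constructor
    · rintro ⟨⟨h1, h2, h3⟩, h4, h5⟩
      exact ⟨⟨⟨h2, h4⟩, h3, h5⟩, fun y _ h6 h7 => h1 (h6.symm.trans h7)⟩
    · rintro ⟨⟨⟨h2, h4⟩, h3, h5⟩, h⟩
      exact ⟨⟨fun h1 => h (x 0) ⟨h2, h4⟩ rfl h1, h2, h3⟩, h4, h5⟩
  have hfin : ((s.1 ∩ A) ×ˢ (s.1 ∩ B)).Finite := hAf.prod hBf
  have hsub : D ⊆ (s.1 ∩ A) ×ˢ (s.1 ∩ B) := by
    rintro _ ⟨x, hx, rfl⟩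
    exact ⟨hx, hx.1, hAB hx.2⟩
  have hcard : D.ncard = count A s :=
    Set.ncard_image_of_injective _ fun x y hxy => (Prod.ext_iff.1 hxy).1
  rw [tupleSum, finsum_mem_indicator_one, h]
  · rw [Set.ncard_preimage_of_injective_subset_range (finTwoArrowEquiv F).injective
      ((Equiv.surjective _).range_eq ▸ Set.subset_univ _)]
    have := Set.ncard_sdiff_add_ncard_of_subset hsub hfin
    rw [hcard, Set.ncard_prod] at this
    rw [eq_sub_iff_add_eq]
    exact_mod_cast this
  · rw [h]
    exact (hfin.subset Set.sdiff_subset).preimage (Equiv.injective _).injOn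

end Configuration

/-! ### First and second moments of the counts in balls -/

section Moments

open Configuration

variable {F Ω : Type*} [NontriviallyNormedField F] [IsUltrametricDist F]
  [MeasurableSpace F] [BorelSpace F] [MeasurableSpace Ω] {P : Measure Ω}
  {X : Ω → Configuration F} {m : Measure F} {K : F → F → ℂ}

/-- The defining identity of a determinantal process, for the indicator function of a product of
compact sets. -/
lemma IsDeterminantal.integral_tupleSum_indicator (hX : IsDeterminantal P X m K) {n : ℕ}
    (hn : 0 < n) (A : Fin n → Set F) (hA : ∀ i, IsCompact (A i)) :
    Integrable (fun ω => (X ω).tupleSum ((Set.univ.pi A).indicator 1)) P ∧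
      ∫ ω, (X ω).tupleSum ((Set.univ.pi A).indicator 1) ∂P =
        ∫ y in Set.univ.pi A, (Matrix.of fun i j => K (y i) (y j)).det
          ∂(Measure.pi fun _ : Fin n => m) := by
  have hmeas : MeasurableSet (Set.univ.pi A) := .univ_pi fun i => (hA i).measurableSet
  have h := hX n hn ((Set.univ.pi A).indicator 1) (measurable_one.indicator hmeas)
    ⟨1, fun x => by by_cases hx : x ∈ Set.univ.pi A <;> simp [hx]⟩
    (HasCompactSupport.intro (isCompact_univ_pi hA) fun x hx => Set.indicator_of_notMem hx _)
  refine ⟨h.1, h.2.trans ?_⟩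
  rw [← integral_indicator hmeas]
  congr 1
  ext y
  by_cases hy : y ∈ Set.univ.pi A <;> simp [hy]

variable [LocallyCompactSpace F] [m.IsAddHaarMeasure] {k : F → ℂ} {κ : ℝ}

lemma IsDeterminantal.integral_count (hX : IsDeterminantal P X m fun x y => k (x - y))
    (hk0 : k 0 = κ) (r : ℝ) :
    Integrable (fun ω => (count (closedBall 0 r) (X ω) : ℝ)) P ∧
      ∫ ω, (count (closedBall 0 r) (X ω) : ℝ) ∂P = m.real (closedBall 0 r) * κ := by
  have : ProperSpace F := .of_nontriviallyNormedField_of_weaklyLocallyCompactSpace F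
  obtain ⟨h1, h2⟩ := hX.integral_tupleSum_indicator one_pos (fun _ => closedBall 0 r)
    fun _ => isCompact_closedBall _ _
  simp only [tupleSum_indicator_one isBounded_closedBall] at h1 h2
  have h3 : Integrable (fun ω => (count (closedBall 0 r) (X ω) : ℝ)) P := by
    simpa using h1.re
  refine ⟨h3, ?_⟩
  rw [← Complex.ofReal_inj, ← integral_complex_ofReal]
  simp only [Complex.ofReal_natCast]
  rw [h2]
  simp only [Matrix.det_fin_one, Matrix.of_apply, sub_self, hk0]
  rw [setIntegral_const, measureReal_def, Measure.pi_pi]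
  simp [measureReal_def]

/-- In an ultrametric space a closed ball around the origin is a subgroup, so that integrating over
it a function of `x - y`, for `x` in the ball, loses the dependence on `x`. -/
lemma setIntegral_closedBall_sub_left (f : F → ℝ) {r : ℝ} {x : F} (hx : x ∈ closedBall (0 : F) r) :
    ∫ y in closedBall (0 : F) r, f (x - y) ∂m = ∫ y in closedBall (0 : F) r, f y ∂m := by
  have : ProperSpace F := .of_nontriviallyNormedField_of_weaklyLocallyCompactSpace F
  rw [← integral_indicator measurableSet_closedBall, ← integral_indicator measurableSet_closedBall,
    ← integral_sub_left_eq_self ((closedBall (0 : F) r).indicator f) m x]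
  congr 1
  ext y
  rw [mem_closedBall_zero_iff] at hx
  have hmem : x - y ∈ closedBall (0 : F) r ↔ y ∈ closedBall (0 : F) r := by
    rw [mem_closedBall_zero_iff, mem_closedBall_zero_iff]
    constructor
    · intro h
      have := IsUltrametricDist.norm_add_le_max x (-(x - y))
      rw [neg_sub, add_sub_cancel, norm_sub_rev] at this
      exact this.trans (max_le hx h)
    · intro h
      have := IsUltrametricDist.norm_add_le_max x (-y)
      rw [← sub_eq_add_neg, norm_neg] at this
      exact this.trans (max_le hx h)
  by_cases hy : y ∈ closedBall (0 : F) r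
  · rw [Set.indicator_of_mem hy, Set.indicator_of_mem (hmem.2 hy)]
  · rw [Set.indicator_of_notMem hy, Set.indicator_of_notMem (hmem.not.2 hy)]

lemma IsDeterminantal.integral_count_mul_count
    (hX : IsDeterminantal P X m fun x y => k (x - y)) (hk : Continuous k) (hk0 : k 0 = κ)
    (hk_neg : ∀ y, k (-y) = (starRingEnd ℂ) (k y)) {r s : ℝ} (hrs : r ≤ s) :
    Integrable (fun ω => (count (closedBall 0 r) (X ω) : ℝ) * count (closedBall 0 s) (X ω)) P ∧
      ∫ ω, (count (closedBall 0 r) (X ω) : ℝ) * count (closedBall 0 s) (X ω) ∂P =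
        (m.real (closedBall 0 r) * κ) * (m.real (closedBall 0 s) * κ) +
        m.real (closedBall 0 r) * (κ - ∫ y in closedBall 0 s, ‖k y‖ ^ 2 ∂m) := by
  have : ProperSpace F := .of_nontriviallyNormedField_of_weaklyLocallyCompactSpace F
  set A := closedBall (0 : F) r with hA
  set B := closedBall (0 : F) s with hB
  have hAB : A ⊆ B := closedBall_subset_closedBall hrs
  have hAc : IsCompact A := isCompact_closedBall _ _
  have hBc : IsCompact B := isCompact_closedBall _ _
  obtain ⟨h1, h2⟩ := hX.integral_tupleSum_indicator two_pos ![A, B]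
    (by simp [Fin.forall_fin_two, hAc, hBc])
  simp only [tupleSum_indicator_two hAB isBounded_closedBall] at h1 h2
  obtain ⟨h3, h4⟩ := hX.integral_count hk0 r
  have h5 : Integrable (fun ω => (count A (X ω) : ℝ) * count B (X ω) - count A (X ω)) P := by
    simpa using h1.re
  have h6 : Integrable (fun ω => (count A (X ω) : ℝ) * count B (X ω)) P := by
    refine (h5.add h3).congr (Eventually.of_forall fun ω => ?_)
    simp [hA]
  refine ⟨h6, ?_⟩
  have h7 : ∫ ω, ((count A (X ω) : ℝ) * count B (X ω) - count A (X ω)) ∂P =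
      ∫ p in A ×ˢ B, (κ ^ 2 - ‖k (p.1 - p.2)‖ ^ 2) ∂(m.prod m) := by
    rw [← Complex.ofReal_inj, ← integral_complex_ofReal, ← integral_complex_ofReal]
    push_cast
    rw [h2, ← (measurePreserving_finTwoArrow m).setIntegral_preimage_emb
      (MeasurableEquiv.measurableEmbedding _)]
    have hpre : Set.univ.pi ![A, B] = MeasurableEquiv.finTwoArrow ⁻¹' (A ×ˢ B) := by
      ext y
      simp [Fin.forall_fin_two]
    rw [hpre]
    congr 1
    ext y
    simp only [Matrix.det_fin_two, Matrix.of_apply, sub_self, hk0]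
    have hy : k (y 0 - y 1) * k (y 1 - y 0) = (‖k (y 0 - y 1)‖ : ℂ) ^ 2 := by
      rw [← neg_sub (y 0) (y 1), hk_neg, Complex.mul_conj']
    rw [hy, sq (κ : ℂ)]
    rfl
  have hcont : Continuous fun p : F × F => κ ^ 2 - ‖k (p.1 - p.2)‖ ^ 2 := by fun_prop
  have h8 : ∫ p in A ×ˢ B, (κ ^ 2 - ‖k (p.1 - p.2)‖ ^ 2) ∂(m.prod m) =
      m.real A * (m.real B * κ ^ 2 - ∫ y in B, ‖k y‖ ^ 2 ∂m) := by
    rw [setIntegral_prod _ (hcont.continuousOn.integrableOn_compact (hAc.prod hBc))]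
    have hinner : ∀ x ∈ A, ∫ y in B, (κ ^ 2 - ‖k (x - y)‖ ^ 2) ∂m =
        m.real B * κ ^ 2 - ∫ y in B, ‖k y‖ ^ 2 ∂m := by
      intro x hx
      rw [setIntegral_closedBall_sub_left (fun y => κ ^ 2 - ‖k y‖ ^ 2) (hAB hx), integral_sub]
      · rw [setIntegral_const, smul_eq_mul]
      · exact continuousOn_const.integrableOn_compact hBc
      · exact (hk.norm.pow 2).continuousOn.integrableOn_compact hBc
    rw [setIntegral_congr_fun hAc.measurableSet hinner, setIntegral_const, smul_eq_mul]
  rw [integral_sub h6 h3, h8, h4] at h7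
  rw [eq_add_of_sub_eq h7]
  ring

lemma IsDeterminantal.memLp_count [IsFiniteMeasure P] (hXm : Measurable X)
    (hX : IsDeterminantal P X m fun x y => k (x - y)) (hk : Continuous k) (hk0 : k 0 = κ)
    (hk_neg : ∀ y, k (-y) = (starRingEnd ℂ) (k y)) (r : ℝ) :
    MemLp (fun ω => (count (closedBall 0 r) (X ω) : ℝ)) 2 P := by
  have hmeas : Measurable fun ω => (count (closedBall 0 r) (X ω) : ℝ) :=
    measurable_from_nat.comp
      ((measurable_count measurableSet_closedBall isBounded_closedBall).comp hXm)
  rw [memLp_two_iff_integrable_sq hmeas.aestronglyMeasurable]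
  simpa only [sq] using (hX.integral_count_mul_count hk hk0 hk_neg le_rfl).1

/-- The covariance of the counts in two concentric balls. With `κ = ∫ ‖k‖²` the last factor is the
mass of `‖k‖²` outside the larger ball. -/
lemma IsDeterminantal.integral_centered_mul_centered [IsProbabilityMeasure P]
    (hX : IsDeterminantal P X m fun x y => k (x - y)) (hk : Continuous k) (hk0 : k 0 = κ)
    (hk_neg : ∀ y, k (-y) = (starRingEnd ℂ) (k y)) {r s : ℝ} (hrs : r ≤ s) :
    ∫ ω, ((count (closedBall 0 r) (X ω) : ℝ) - m.real (closedBall 0 r) * κ) *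
        ((count (closedBall 0 s) (X ω) : ℝ) - m.real (closedBall 0 s) * κ) ∂P =
      m.real (closedBall 0 r) * (κ - ∫ y in closedBall 0 s, ‖k y‖ ^ 2 ∂m) := by
  obtain ⟨hr1, hr2⟩ := hX.integral_count hk0 r
  obtain ⟨hs1, hs2⟩ := hX.integral_count hk0 s
  obtain ⟨h1, h2⟩ := hX.integral_count_mul_count hk hk0 hk_neg hrs
  set a := m.real (closedBall (0 : F) r) * κ
  set b := m.real (closedBall (0 : F) s) * κ
  have h3 : ∀ ω, ((count (closedBall 0 r) (X ω) : ℝ) - a) * ((count (closedBall 0 s) (X ω) : ℝ) - b)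
      = (count (closedBall 0 r) (X ω) : ℝ) * count (closedBall 0 s) (X ω) -
        b * count (closedBall 0 r) (X ω) - a * (count (closedBall 0 s) (X ω) - b) := fun ω => by ring
  simp only [h3]
  have h4 : Integrable (fun ω => (count (closedBall 0 r) (X ω) : ℝ) * count (closedBall 0 s) (X ω) -
      b * count (closedBall 0 r) (X ω)) P := h1.sub (hr1.const_mul b)
  have h5 : Integrable (fun ω => (count (closedBall 0 s) (X ω) : ℝ) - b) P :=
    hs1.sub (integrable_const b)
  rw [integral_sub h4 (h5.const_mul a),
    integral_sub h1 (hr1.const_mul b), integral_const_mul, integral_const_mul,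
    integral_sub hs1 (integrable_const b), h2, hr2, hs2]
  simp
  ring

end Moments

/-! ### Number rigidity -/

theorem theorem2
    -- a non-discrete non-Archimedean local field with its standard norm
    {F : Type*} [NontriviallyNormedField F] [IsUltrametricDist F] [LocallyCompactSpace F]
    (hF : IsStandardNorm F)
    -- the Haar measure, normalized on the valuation ring
    [MeasurableSpace F] [BorelSpace F] (m : Measure F) [m.IsAddHaarMeasure]
    (hm : m (Metric.closedBall 0 1) = 1)
    -- the fixed character, trivial on the valuation ring and not on the ball of radius `q`
    (χ : AddChar F Circle) (hχ : Continuous χ)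
    (hχ_one : ∀ x : F, ‖x‖ ≤ 1 → χ x = 1)
    (hχ_ne : ∃ x : F, ‖x‖ ≤ (residueCard F : ℝ) ∧ χ x ≠ 1)
    (S : Set F) (hS : MeasurableSet S) (hS_pos : 0 < m S) (hS_fin : m S < ⊤)
    (hdecay :
      (fun n : ℕ => ∫ y in (Metric.closedBall (0 : F) ((residueCard F : ℝ) ^ n))ᶜ,
          ‖charFourier χ m (S.indicator 1) y‖ ^ 2 ∂m)
        =O[atTop] fun n : ℕ => ((residueCard F : ℝ) ^ n)⁻¹)
    -- a determinantal point process induced by the kernel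
    {Ω : Type*} [MeasurableSpace Ω] (P : Measure Ω) [IsProbabilityMeasure P]
    (X : Ω → Configuration F) (hX : Measurable X)
    (hX_det : IsDeterminantal P X m fun x y => charFourier χ m (S.indicator 1) (x - y)) :
    IsNumberRigid P X := by
  intro B _ hB
  have hq := one_lt_residueCard hF
  have hq0 : (0 : ℝ) < residueCard F := by linarith
  set k := charFourier χ m (S.indicator 1)
  have hk : Continuous k := continuous_charFourier_indicator m χ hχ hS hS_fin
  have hk0 : k 0 = (m.real S : ℂ) := charFourier_indicator_zero χ m hS
  have hk_neg : ∀ y, k (-y) = (starRingEnd ℂ) (k y) := charFourier_indicator_neg χ m hS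
  -- the balls start at radius `q ^ n₀`, large enough to contain `B` and for the decay bound to hold
  obtain ⟨C, hC, hdecay⟩ := hdecay.exists_pos
  rw [isBigOWith_iff, eventually_atTop] at hdecay
  obtain ⟨n₁, hn₁⟩ := hdecay
  obtain ⟨R, hR⟩ := hB.subset_closedBall 0
  obtain ⟨n₂, hn₂⟩ := pow_unbounded_of_one_lt R hq
  set n₀ := max n₁ n₂
  have hball : ∀ j, B ⊆ closedBall (0 : F) ((residueCard F : ℝ) ^ (n₀ + j)) := fun j =>
    hR.trans (closedBall_subset_closedBall (hn₂.le.trans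
      (pow_le_pow_right₀ hq.le (by omega))))
  set Y : ℕ → Ω → ℝ := fun j ω =>
    ((X ω).count (closedBall (0 : F) ((residueCard F : ℝ) ^ (n₀ + j))) : ℝ) -
      m.real (closedBall (0 : F) ((residueCard F : ℝ) ^ (n₀ + j))) * m.real S with hY
  have hY2 : ∀ j, MemLp (Y j) 2 P := fun j =>
    (hX_det.memLp_count hX hk hk0 hk_neg _).sub (memLp_const _)
  have hcov : ∀ i d, ∫ ω, Y i ω * Y (i + d) ω ∂P ≤ C * ((residueCard F : ℝ)⁻¹) ^ d := by
    intro i d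
    have hle : (residueCard F : ℝ) ^ (n₀ + i) ≤ (residueCard F : ℝ) ^ (n₀ + (i + d)) :=
      pow_le_pow_right₀ hq.le (by omega)
    simp only [hY]
    rw [hX_det.integral_centered_mul_centered hk hk0 hk_neg hle,
      ← setIntegral_compl_norm_charFourier_sq m hF hm χ hχ hχ_one hχ_ne hS hS_fin]
    have h1 := measureReal_closedBall_zpow m hF hm 0 ((n₀ + i : ℕ) : ℤ)
    rw [zpow_natCast] at h1
    have h2 := (le_abs_self _).trans (hn₁ (n₀ + (i + d)) (by omega))
    rw [Real.norm_of_nonneg (by positivity)] at h2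
    rw [h1]
    calc _ ≤ (residueCard F : ℝ) ^ (n₀ + i) * (C * ((residueCard F : ℝ) ^ (n₀ + (i + d)))⁻¹) := by
          gcongr
      _ = C * ((residueCard F : ℝ)⁻¹) ^ d := by
          rw [← add_assoc, pow_add _ (n₀ + i) d, inv_pow]
          field_simp
  obtain ⟨ns, hns, hlim⟩ := exists_seq_tendsto_average hY2 hC.le (inv_nonneg.2 hq0.le)
    (inv_lt_one_of_one_lt₀ hq) hcov
  exact exists_measurable_count_eq hball (fun j => measurableSet_closedBall)
    (fun j => isBounded_closedBall) hns hlim
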